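/- Let $D\subset\mathbb{R}^d$ be a bounded open set. For $E\subset\mathbb{R}^d$ let $\operatorname{Cap}(E)=\inf\int_{\mathbb{R}^d}(|\nabla u|^2+u^2)\,dx$, the infimum being over all $u\in H^1(\mathbb{R}^d)$ with $u\ge 1$ a.e. in a neighborhood of $E$; a property holds quasi-everywhere (q.e.) if it holds outside a set of capacity zero. A set $A\subset\mathbb{R}^d$ is quasi-open if for every $\varepsilon>0$ there is an open set $A_\varepsilon$ with $\operatorname{Cap}(A_\varepsilon\,\triangle\,A)<\varepsilon$, and $\mathcal{A}(D)$ denotes the class of all quasi-open subsets of $D$. A function $u:D\to\mathbb{R}$ is quasi-continuous if for every $\varepsilon>0$ there is a continuous $u_\varepsilon:D\to\mathbb{R}$ with $\operatorname{Cap}(\{u\ne u_\varepsilon\})<\varepsilon$. Elements of $H^1_0(D)$, the closure of $C_c^\infty(D)$ in the $H^1$ norm, are evaluated pointwise through their quasi-continuous representatives, which are unique up to sets of capacity zero. For $\Omega\in\mathcal{A}(D)$ let $H^1_0(\Omega)$ be the set of $u\in H^1_0(D)$ with $u=0$ q.e. on $D\setminus\Omega$, and let $w_\Omega\in H^1_0(\Omega)$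 be the weak solution of $-\Delta w=1$ in $\Omega$, that is, $\int_D\nabla w_\Omega\cdot\nabla v\,dx=\int_D v\,dx$ for all $v\in H^1_0(\Omega)$. A sequence $(\Omega_n)$ in $\mathcal{A}(D)$ weakly $\gamma$-converges to $\Omega\in\mathcal{A}(D)$ if $w_{\Omega_n}$ converges weakly in $H^1_0(D)$ to some $w\in H^1_0(D)$ having a quasi-continuous representative $\tilde w$ with $\Omega=\{x\in D:\tilde w(x)>0\}$. **Proposition.** Let $f\in L^1(D)$ be nonnegative. Then the map $\Omega\mapsto\int_\Omega f\,dx$ is lower semicontinuous on $\mathcal{A}(D)$ with respect to weak $\gamma$-convergence: whenever $\Omega_n,\Omega\in\mathcal{A}(D)$ and $(\Omega_n)$ weakly $\gamma$-converges to $\Omega$, $$\int_\Omega f\,dx\le\liminf_{n\to\infty}\int_{\Omega_n}f\,dx .$$ -/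

import Mathlib

open MeasureTheory Filter Topology
open scoped ENNReal ContDiff

namespace ShapeOpt

noncomputable section

/-- `φ ∈ C_c^∞(U)`. -/
def IsTestFunction {d : ℕ} (U : Set (EuclideanSpace ℝ (Fin d)))
    (φ : EuclideanSpace ℝ (Fin d) → ℝ) : Prop :=
  ContDiff ℝ ∞ φ ∧ HasCompactSupport φ ∧ tsupport φ ⊆ U

/-- `g` is the weak (distributional) gradient of `u` on the whole space. -/
def HasWeakGradient {d : ℕ} (u : EuclideanSpace ℝ (Fin d) → ℝ)
    (g : EuclideanSpace ℝ (Fin d) → EuclideanSpace ℝ (Fin d)) : Prop :=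
  ∀ φ, IsTestFunction Set.univ φ → ∀ e : EuclideanSpace ℝ (Fin d),
    ∫ x, u x * fderiv ℝ φ x e = -∫ x, φ x * inner ℝ (g x) e

/-- `u ∈ H¹(ℝᵈ)`, with weak gradient `g`. -/
def IsH1 {d : ℕ} (u : EuclideanSpace ℝ (Fin d) → ℝ)
    (g : EuclideanSpace ℝ (Fin d) → EuclideanSpace ℝ (Fin d)) : Prop :=
  MemLp u 2 volume ∧ MemLp g 2 volume ∧ HasWeakGradient u g

/-- The capacity of an arbitrary subset of `ℝᵈ`: the infimum of `∫ |∇u|² + u²` over all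
`u ∈ H¹(ℝᵈ)` with `u ≥ 1` almost everywhere in a neighbourhood of the set (the value is `∞` if
there is no such `u`). -/
def capacity {d : ℕ} (A : Set (EuclideanSpace ℝ (Fin d))) : ℝ≥0∞ :=
  ⨅ (u : EuclideanSpace ℝ (Fin d) → ℝ)
    (g : EuclideanSpace ℝ (Fin d) → EuclideanSpace ℝ (Fin d))
    (_ : IsH1 u g)
    (_ : ∃ U, IsOpen U ∧ A ⊆ U ∧ ∀ᵐ x ∂(volume.restrict U), 1 ≤ u x),
    ∫⁻ x, (‖g x‖ₑ ^ 2 + ‖u x‖ₑ ^ 2)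

/-- Quasi-open sets. -/
def IsQuasiOpen {d : ℕ} (A : Set (EuclideanSpace ℝ (Fin d))) : Prop :=
  ∀ ε : ℝ≥0∞, 0 < ε → ∃ V, IsOpen V ∧ capacity (symmDiff V A) < ε

/-- The class `𝒜(D)` of all quasi-open subsets of `D`. -/
def quasiOpenSubsets {d : ℕ} (D : Set (EuclideanSpace ℝ (Fin d))) :
    Set (Set (EuclideanSpace ℝ (Fin d))) :=
  {A | IsQuasiOpen A ∧ A ⊆ D}

/-- Quasi-continuity on `D` (only the values of `u` on `D` matter). -/
def IsQuasiContinuousOn {d : ℕ} (u : EuclideanSpace ℝ (Fin d) → ℝ)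
    (D : Set (EuclideanSpace ℝ (Fin d))) : Prop :=
  ∀ ε : ℝ≥0∞, 0 < ε → ∃ v : EuclideanSpace ℝ (Fin d) → ℝ,
    ContinuousOn v D ∧ capacity {x | x ∈ D ∧ u x ≠ v x} < ε

/-- The Hilbert space `L²(D) × L²(D; ℝᵈ)`. -/
abbrev L2Pair {d : ℕ} (D : Set (EuclideanSpace ℝ (Fin d))) : Type :=
  WithLp 2 (Lp ℝ 2 (volume.restrict D) ×
    Lp (EuclideanSpace ℝ (Fin d)) 2 (volume.restrict D))

/-- The Hilbert space `H¹₀(D)`, the closure of `C_c^∞(D)` in the `H¹` norm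
`(∫_D u² + |∇u|²)^(1/2)`. An element is the pair `(u, ∇u)`. -/
def H10 {d : ℕ} (D : Set (EuclideanSpace ℝ (Fin d))) : Submodule ℝ (L2Pair D) :=
  (Submodule.span ℝ {p : L2Pair D | ∃ φ, IsTestFunction D φ ∧
    p.fst =ᵐ[volume.restrict D] φ ∧
    p.snd =ᵐ[volume.restrict D] gradient φ}).topologicalClosure

/-- The function `u ∈ L²(D)` underlying an element of `H¹₀(D)`. -/
def sobFn {d : ℕ} {D : Set (EuclideanSpace ℝ (Fin d))} (u : H10 D) :
    Lp ℝ 2 (volume.restrict D) :=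
  (u : L2Pair D).fst

/-- The gradient `∇u ∈ L²(D; ℝᵈ)` of an element `u` of `H¹₀(D)`. -/
def sobGrad {d : ℕ} {D : Set (EuclideanSpace ℝ (Fin d))} (u : H10 D) :
    Lp (EuclideanSpace ℝ (Fin d)) 2 (volume.restrict D) :=
  (u : L2Pair D).snd

/-- `r` is a quasi-continuous representative of `u ∈ H¹₀(D)`. -/
def IsQuasiContinuousRep {d : ℕ} {D : Set (EuclideanSpace ℝ (Fin d))} (u : H10 D)
    (r : EuclideanSpace ℝ (Fin d) → ℝ) : Prop :=
  IsQuasiContinuousOn r D ∧ sobFn u =ᵐ[volume.restrict D] r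

/-- `u ∈ H¹₀(Ω)`, for a subset `Ω` of `D`: the element `u` of `H¹₀(D)` vanishes quasi-everywhere
on `D \ Ω`. -/
def MemH10 {d : ℕ} {D : Set (EuclideanSpace ℝ (Fin d))} (Ω : Set (EuclideanSpace ℝ (Fin d)))
    (u : H10 D) : Prop :=
  ∃ r, IsQuasiContinuousRep u r ∧ capacity {x | x ∈ D \ Ω ∧ r x ≠ 0} = 0

/-- `w = R_Ω(f)`: `w` is the weak solution of `-Δw = f` in `Ω`, `w ∈ H¹₀(Ω)`. -/
def IsDirichletSolution {d : ℕ} {D : Set (EuclideanSpace ℝ (Fin d))}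
    (Ω : Set (EuclideanSpace ℝ (Fin d))) (f : EuclideanSpace ℝ (Fin d) → ℝ) (w : H10 D) : Prop :=
  MemH10 Ω w ∧ ∀ v : H10 D, MemH10 Ω v →
    ∫ x in D, inner ℝ (sobGrad w x) (sobGrad v x) = ∫ x in D, f x * sobFn v x

/-- Weak `γ`-convergence of `Ωₙ` to `Ω`: the torsion functions `wₙ = R_{Ωₙ}(1)` converge weakly
in `H¹₀(D)` to some `w` which has a quasi-continuous representative `r` with `Ω = {r > 0}`.
(Two quasi-continuous representatives differ on a set of capacity zero only, and changing one on
such a set yields another one.) -/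
def WeakGammaTendsto {d : ℕ} (D : Set (EuclideanSpace ℝ (Fin d)))
    (Ωs : ℕ → Set (EuclideanSpace ℝ (Fin d))) (Ω : Set (EuclideanSpace ℝ (Fin d))) : Prop :=
  ∃ (ws : ℕ → H10 D) (w : H10 D) (r : EuclideanSpace ℝ (Fin d) → ℝ),
    (∀ n, IsDirichletSolution (Ωs n) (fun _ => 1) (ws n)) ∧
    Tendsto (fun n => toWeakSpace ℝ (H10 D) (ws n)) atTop (𝓝 (toWeakSpace ℝ (H10 D) w)) ∧
    IsQuasiContinuousRep w r ∧ Ω = {x | x ∈ D ∧ 0 < r x}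

/-- Lower semicontinuity on `𝒜(D)` of a shape functional along weakly `γ`-convergent
sequences. -/
def WeakGammaLSC {d : ℕ} (D : Set (EuclideanSpace ℝ (Fin d)))
    (F : Set (EuclideanSpace ℝ (Fin d)) → EReal) : Prop :=
  ∀ (Ωs : ℕ → Set (EuclideanSpace ℝ (Fin d))) (Ω : Set (EuclideanSpace ℝ (Fin d))),
    (∀ n, Ωs n ∈ quasiOpenSubsets D) → Ω ∈ quasiOpenSubsets D →
    WeakGammaTendsto D Ωs Ω → F Ω ≤ liminf (fun n => F (Ωs n)) atTop

end

end ShapeOpt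

namespace ShapeOpt

open Metric Set

/-! Weak convergence in `H10 D` becomes strong convergence in L¹(D) by a Rellich argument, hence
convergence in measure of the torsion functions wₙ to w. At a point where w > 0, along an a.e.
convergent subsequence, wₙ is eventually positive, so by dominated convergence the f-mass of {w > 0,
wₙ = 0} tends to 0 (`tendsto_setIntegral_pos_inter_eq_zero`). The rest of {w > 0} lies in {wₙ ≠ 0},
which is contained in Ωₙ up to a Lebesgue-null set because capacity dominates volume. As f ≥ 0, ∫_Ω
f is at most ∫_{Ωₙ} f plus a vanishing error.

Rellich is proved by averaging over balls of radius ε. Uniformly on bounded sets of `H10 D`, a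
function is within O(ε) in L¹(D) of its averages. For fixed ε each average is a continuous linear
functional, so weak convergence makes the averages converge pointwise. -/

/-- The capacity dominates the Lebesgue measure. -/
theorem volume_le_capacity {d : ℕ} (A : Set (EuclideanSpace ℝ (Fin d))) :
    volume A ≤ capacity A := by
  refine le_iInf fun u => le_iInf fun g => le_iInf fun _ => le_iInf ?_
  rintro ⟨U, hU, hAU, hu⟩
  calc volume A ≤ volume U := measure_mono hAU
    _ = ∫⁻ _ in U, 1 := by simp
    _ ≤ ∫⁻ x in U, (‖g x‖ₑ ^ 2 + ‖u x‖ₑ ^ 2) := by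
        refine lintegral_mono_ae (hu.mono fun x hx => ?_)
        have h1 : (1 : ℝ≥0∞) ≤ ‖u x‖ₑ := by
          rw [Real.enorm_eq_ofReal (zero_le_one.trans hx)]
          simpa using hx
        calc (1 : ℝ≥0∞) ≤ ‖u x‖ₑ ^ 2 := one_le_pow₀ h1
          _ ≤ _ := le_add_self
    _ ≤ _ := setLIntegral_le_lintegral _ _

/-! ### L¹ distance between a function and its ball averages -/

section Averages

theorem enorm_add_sub_le_lintegral_fderiv {E : Type*} [NormedAddCommGroup E]
    [NormedSpace ℝ E] {φ : E → ℝ} (hφ : ContDiff ℝ 1 φ) (x h : E) :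
    ‖φ (x + h) - φ x‖ₑ ≤ ‖h‖ₑ * ∫⁻ t in Icc (0 : ℝ) 1, ‖fderiv ℝ φ (x + t • h)‖ₑ := by
  have hline : ContDiff ℝ 1 fun t : ℝ => φ (x + t • h) := by fun_prop
  have key := enorm_sub_le_lintegral_deriv_of_contDiffOn_Icc (a := 0) (b := 1)
    hline.contDiffOn zero_le_one
  simp only [one_smul, zero_smul, add_zero] at key
  refine key.trans ?_
  rw [← lintegral_const_mul' _ _ enorm_ne_top]
  refine lintegral_mono fun t => ?_
  have hd : HasDerivAt (fun t : ℝ => φ (x + t • h)) (fderiv ℝ φ (x + t • h) h) t := by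
    have h1 : HasDerivAt (fun t : ℝ => x + t • h) h t := by
      simpa using ((hasDerivAt_id t).smul_const h).const_add x
    exact ((hφ.differentiable one_ne_zero _).hasFDerivAt).comp_hasDerivAt t h1
  rw [hd.deriv, mul_comm]
  exact ContinuousLinearMap.le_opENorm _ _

theorem setIntegral_ball_eq {E : Type*} [NormedAddCommGroup E] [MeasurableSpace E] [BorelSpace E]
    {μ : Measure E} [μ.IsAddLeftInvariant] (φ : E → ℝ) (x : E) (ε : ℝ) :
    ∫ y in ball x ε, φ y ∂μ = ∫ h in ball 0 ε, φ (x + h) ∂μ := by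
  have := (measurePreserving_add_left μ x).setIntegral_preimage_emb
    (MeasurableEquiv.addLeft x).measurableEmbedding φ (ball x ε)
  rw [← this, preimage_add_ball, sub_self]

variable {E : Type*} [NormedAddCommGroup E] [NormedSpace ℝ E] [FiniteDimensional ℝ E]
  [MeasurableSpace E] [BorelSpace E] {μ : Measure E} [μ.IsAddHaarMeasure]

/-- Integrate the bound along the segment from x to x + h and swap the integrals: by translation
invariance every t-slice contributes the same integral. -/
theorem lintegral_enorm_add_sub_le {φ : E → ℝ} (hφ : ContDiff ℝ 1 φ) (h : E) :
    ∫⁻ x, ‖φ (x + h) - φ x‖ₑ ∂μ ≤ ‖h‖ₑ * ∫⁻ x, ‖fderiv ℝ φ x‖ₑ ∂μ := by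
  have hc : Continuous (fderiv ℝ φ) := hφ.continuous_fderiv one_ne_zero
  calc ∫⁻ x, ‖φ (x + h) - φ x‖ₑ ∂μ
      ≤ ∫⁻ x, (‖h‖ₑ * ∫⁻ t in Icc (0 : ℝ) 1, ‖fderiv ℝ φ (x + t • h)‖ₑ) ∂μ :=
        lintegral_mono fun x => enorm_add_sub_le_lintegral_fderiv hφ x h
    _ = ‖h‖ₑ * ∫⁻ t in Icc (0 : ℝ) 1, ∫⁻ x, ‖fderiv ℝ φ (x + t • h)‖ₑ ∂μ := by
        rw [lintegral_const_mul' _ _ enorm_ne_top, lintegral_lintegral_swap]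
        exact Continuous.aemeasurable (by fun_prop)
    _ = ‖h‖ₑ * ∫⁻ x, ‖fderiv ℝ φ x‖ₑ ∂μ := by
        simp_rw [fun t : ℝ => lintegral_add_right_eq_self (μ := μ)
          (fun x => ‖fderiv ℝ φ x‖ₑ) (t • h)]
        simp

/-- A `C¹` function is close in `L¹` to its averages over small balls. -/
theorem lintegral_enorm_sub_setIntegral_ball_le {φ : E → ℝ} (hφ : ContDiff ℝ 1 φ) (ε : ℝ) :
    ∫⁻ x, ‖μ.real (ball 0 ε) * φ x - ∫ y in ball x ε, φ y ∂μ‖ₑ ∂μ ≤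
      ENNReal.ofReal ε * μ (ball 0 ε) * ∫⁻ x, ‖fderiv ℝ φ x‖ₑ ∂μ := by
  have hc : Continuous φ := hφ.continuous
  calc ∫⁻ x, ‖μ.real (ball 0 ε) * φ x - ∫ y in ball x ε, φ y ∂μ‖ₑ ∂μ
      ≤ ∫⁻ x, ∫⁻ h in ball 0 ε, ‖φ (x + h) - φ x‖ₑ ∂μ ∂μ := by
        refine lintegral_mono fun x => ?_
        have hint : IntegrableOn (fun h => φ (x + h)) (ball 0 ε) μ :=
          ((by fun_prop : Continuous fun h => φ (x + h)).continuousOn.integrableOn_compact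
            (isCompact_closedBall 0 ε)).mono_set ball_subset_closedBall
        have hcst : IntegrableOn (fun _ => φ x) (ball 0 ε) μ :=
          integrableOn_const measure_ball_lt_top.ne
        -- The averages are left unnormalised, so no division by the volume of the ball is needed
        -- here.
        have : μ.real (ball 0 ε) * φ x - ∫ y in ball x ε, φ y ∂μ
            = - ∫ h in ball 0 ε, (φ (x + h) - φ x) ∂μ := by
          rw [integral_sub hint hcst, setIntegral_const, setIntegral_ball_eq, smul_eq_mul]
          ring
        rw [this, enorm_neg]
        exact enorm_integral_le_lintegral_enorm _
    _ = ∫⁻ h in ball 0 ε, ∫⁻ x, ‖φ (x + h) - φ x‖ₑ ∂μ ∂μ := by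
        rw [lintegral_lintegral_swap]
        exact Continuous.aemeasurable (by fun_prop)
    _ ≤ ∫⁻ h in ball 0 ε, ENNReal.ofReal ε * ∫⁻ x, ‖fderiv ℝ φ x‖ₑ ∂μ ∂μ := by
        refine setLIntegral_mono' measurableSet_ball fun h hh => ?_
        refine (lintegral_enorm_add_sub_le hφ h).trans ?_
        gcongr
        rw [← ofReal_norm]
        exact ENNReal.ofReal_le_ofReal (mem_ball_zero_iff.1 hh).le
    _ = _ := by
        rw [setLIntegral_const]
        ring

/-- The ball average is a partial integral of a function on the product, cut off by the open set of
pairs at distance less than ε. -/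
theorem measurable_setIntegral_ball {ν : Measure E} [SFinite ν] {u : E → ℝ}
    (hu : StronglyMeasurable u) (ε : ℝ) :
    StronglyMeasurable fun x => ∫ y in ball x ε, u y ∂ν := by
  have hS : MeasurableSet {p : E × E | dist p.2 p.1 < ε} :=
    (isOpen_lt (by fun_prop) continuous_const).measurableSet
  have h : StronglyMeasurable ({p : E × E | dist p.2 p.1 < ε}.indicator fun p => u p.2) :=
    (hu.comp_measurable measurable_snd).indicator hS
  convert h.integral_prod_right' (ν := ν) using 2 with x
  rw [← integral_indicator measurableSet_ball]
  rfl

end Averages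

/-! ### Weakly convergent sequences -/

theorem tendsto_apply_of_tendsto_toWeakSpace {H : Type*} [NormedAddCommGroup H]
    [NormedSpace ℝ H] {v : ℕ → H} {w : H}
    (h : Tendsto (fun n => toWeakSpace ℝ H (v n)) atTop (𝓝 (toWeakSpace ℝ H w)))
    (l : StrongDual ℝ H) : Tendsto (fun n => l (v n)) atTop (𝓝 (l w)) :=
  ((WeakBilin.eval_continuous (topDualPairing ℝ H).flip l).tendsto _).comp h

/-- Uniform boundedness for the images in the bidual, which are pointwise bounded on the dual. -/
theorem exists_norm_le_of_tendsto_toWeakSpace {H : Type*} [NormedAddCommGroup H]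
    [NormedSpace ℝ H] {v : ℕ → H} {w : H}
    (h : Tendsto (fun n => toWeakSpace ℝ H (v n)) atTop (𝓝 (toWeakSpace ℝ H w))) :
    ∃ M, ∀ n, ‖v n‖ ≤ M := by
  obtain ⟨M, hM⟩ := banach_steinhaus (g := fun n => NormedSpace.inclusionInDoubleDual ℝ H (v n))
    fun l => by
      obtain ⟨C, hC⟩ := (tendsto_apply_of_tendsto_toWeakSpace h l).norm.bddAbove_range
      exact ⟨C, fun n => hC ⟨n, rfl⟩⟩
  exact ⟨M, fun n => by
    simpa using ((NormedSpace.inclusionInDoubleDualLi ℝ).norm_map (v n)).symm.le.trans (hM n)⟩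

variable {d : ℕ} {D : Set (EuclideanSpace ℝ (Fin d))}

/-! ### The averaging estimate on `H10 D` -/

/-- The generating pairs already form a subspace, so elements of `H10 D` are limits of genuine test
functions. -/
theorem exists_testFunction_of_mem_span {p : L2Pair D}
    (hp : p ∈ Submodule.span ℝ {p : L2Pair D | ∃ φ, IsTestFunction D φ ∧
      p.fst =ᵐ[volume.restrict D] φ ∧ p.snd =ᵐ[volume.restrict D] gradient φ}) :
    ∃ φ, IsTestFunction D φ ∧
      p.fst =ᵐ[volume.restrict D] φ ∧ p.snd =ᵐ[volume.restrict D] gradient φ := by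
  induction hp using Submodule.span_induction with
  | mem p hp => exact hp
  | zero =>
    refine ⟨fun _ => 0, ⟨contDiff_const, HasCompactSupport.zero, by simp [tsupport]⟩, ?_, ?_⟩
    · exact Lp.coeFn_zero _ _ _
    · filter_upwards [Lp.coeFn_zero (EuclideanSpace ℝ (Fin d)) 2 (volume.restrict D)] with x hx
      simpa using hx
  | add p q _ _ ihp ihq =>
    obtain ⟨φ, ⟨hφ, hφc, hφD⟩, hp1, hp2⟩ := ihp
    obtain ⟨ψ, ⟨hψ, hψc, hψD⟩, hq1, hq2⟩ := ihq
    refine ⟨φ + ψ, ⟨hφ.add hψ, hφc.add hψc,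
      (tsupport_add _ _).trans (union_subset hφD hψD)⟩, ?_, ?_⟩
    · exact (Lp.coeFn_add p.fst q.fst).trans (hp1.add hq1)
    · filter_upwards [Lp.coeFn_add p.snd q.snd, hp2, hq2] with x hx h1 h2
      rw [WithLp.add_snd, hx, Pi.add_apply, h1, h2, gradient, gradient, gradient, ← map_add,
        fderiv_add (hφ.differentiable (by simp) x) (hψ.differentiable (by simp) x)]
  | smul c p _ ihp =>
    obtain ⟨φ, ⟨hφ, hφc, hφD⟩, hp1, hp2⟩ := ihp
    refine ⟨c • φ, ⟨hφ.const_smul c, hφc.smul_left, (tsupport_smul_subset_right (fun _ => c) φ).trans hφD⟩,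
      ?_, ?_⟩
    · exact (Lp.coeFn_smul c p.fst).trans (hp1.const_smul c)
    · filter_upwards [Lp.coeFn_smul c p.snd, hp2] with x hx h1
      rw [WithLp.smul_snd, hx, Pi.smul_apply, h1, gradient, gradient,
        fderiv_const_smul (hφ.differentiable (by simp) x)]
      simp

theorem lintegral_enorm_le_of_Lp_two {α F : Type*} [MeasurableSpace α] {μ : Measure α}
    [NormedAddCommGroup F] (u : Lp F 2 μ) :
    ∫⁻ x, ‖u x‖ₑ ∂μ ≤ ‖u‖ₑ * μ univ ^ (1 / 2 : ℝ) := by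
  have h := eLpNorm_le_eLpNorm_mul_rpow_measure_univ (p := 1) (q := 2) (μ := μ) (by norm_num)
    (Lp.aestronglyMeasurable u)
  rw [eLpNorm_one_eq_lintegral_enorm, ← Lp.enorm_def] at h
  convert h using 3
  norm_num

/-- `u ↦ ∫_{B(x, ε)} u` as a continuous functional on `L²(μ)`. -/
theorem exists_clm_setIntegral_ball {E : Type*} [PseudoMetricSpace E] [MeasurableSpace E]
    [OpensMeasurableSpace E] (μ : Measure E) [IsFiniteMeasure μ] (ε : ℝ) (x : E) :
    ∃ l : StrongDual ℝ (Lp ℝ 2 μ), ‖l‖ ≤ μ.real univ ^ (1 / 2 : ℝ) ∧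
      ∀ u, l u = ∫ y in ball x ε, u y ∂μ := by
  refine ⟨innerSL ℝ (indicatorConstLp 2 (measurableSet_ball (x := x) (ε := ε))
    (measure_ne_top μ _) (1 : ℝ)), ?_, fun u => ?_⟩
  · rw [innerSL_apply_norm, norm_indicatorConstLp (by norm_num) (by norm_num)]
    simp only [norm_one, one_mul, ENNReal.toReal_ofNat]
    exact Real.rpow_le_rpow measureReal_nonneg (measureReal_mono (subset_univ _)) (by norm_num)
  · exact L2.inner_indicatorConstLp_one _ _ u

/-- Since φ and its derivative vanish off D, averages over D are averages over the whole space,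
where the C¹ estimate applies; Cauchy–Schwarz then bounds the L¹ norm of the gradient on D. -/
theorem lintegral_enorm_sub_average_le_of_testFunction {p : L2Pair D}
    {φ : EuclideanSpace ℝ (Fin d) → ℝ} (hφ : IsTestFunction D φ)
    (h1 : p.fst =ᵐ[volume.restrict D] φ) (h2 : p.snd =ᵐ[volume.restrict D] gradient φ) (ε : ℝ) :
    ∫⁻ x in D, ‖volume.real (ball (0 : EuclideanSpace ℝ (Fin d)) ε) * p.fst x
        - ∫ y in ball x ε, p.fst y ∂(volume.restrict D)‖ₑ ≤
      ENNReal.ofReal ε * volume (ball (0 : EuclideanSpace ℝ (Fin d)) ε) *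
        (‖p‖ₑ * volume D ^ (1 / 2 : ℝ)) := by
  have hsupp (x) (hx : x ∉ D) : φ x = 0 := image_eq_zero_of_notMem_tsupport fun h => hx (hφ.2.2 h)
  have hgrad (x) (hx : x ∉ D) : fderiv ℝ φ x = 0 := by
    by_contra h
    exact hx (hφ.2.2 (support_fderiv_subset ℝ h))
  calc _ = ∫⁻ x in D, ‖volume.real (ball (0 : EuclideanSpace ℝ (Fin d)) ε) * φ x
        - ∫ y in ball x ε, φ y‖ₑ := by
        refine lintegral_congr_ae (h1.mono fun x hx => ?_)
        have : ∫ y in ball x ε, p.fst y ∂(volume.restrict D) = ∫ y in ball x ε, φ y := by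
          rw [integral_congr_ae (ae_restrict_of_ae h1),
            Measure.restrict_restrict measurableSet_ball]
          refine setIntegral_eq_of_subset_of_forall_sdiff_eq_zero measurableSet_ball
            inter_subset_left (fun y hy => hsupp y fun h => hy.2 ⟨hy.1, h⟩) |>.symm
        simp only [hx, this]
    _ ≤ ∫⁻ x, ‖volume.real (ball (0 : EuclideanSpace ℝ (Fin d)) ε) * φ x
        - ∫ y in ball x ε, φ y‖ₑ := setLIntegral_le_lintegral _ _
    _ ≤ ENNReal.ofReal ε * volume (ball (0 : EuclideanSpace ℝ (Fin d)) ε) *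
        ∫⁻ x, ‖fderiv ℝ φ x‖ₑ :=
        lintegral_enorm_sub_setIntegral_ball_le (hφ.1.of_le (by simp)) ε
    _ = ENNReal.ofReal ε * volume (ball (0 : EuclideanSpace ℝ (Fin d)) ε) *
        ∫⁻ x in D, ‖p.snd x‖ₑ := by
        congr 1
        rw [← setLIntegral_eq_of_support_subset (s := D)]
        · refine lintegral_congr_ae (h2.mono fun x hx => ?_)
          simp only [hx, gradient]
          rw [← ofReal_norm, ← ofReal_norm, LinearIsometryEquiv.norm_map]
        · intro x hx
          by_contra h
          exact hx (by beta_reduce; rw [← ofReal_norm, hgrad x h, norm_zero, ENNReal.ofReal_zero])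
    _ ≤ _ := by
        gcongr
        refine (lintegral_enorm_le_of_Lp_two _).trans ?_
        rw [Measure.restrict_apply_univ]
        gcongr
        exact WithLp.enorm_snd_le _ _

/-- Approximate by test functions. Along a subsequence they converge a.e., their averages converge
at every point by L² continuity, and Fatou's lemma carries the estimate to the limit. -/
theorem lintegral_enorm_sub_average_le (hfin : volume D ≠ ⊤)
    (p : H10 D) (ε : ℝ) :
    ∫⁻ x in D, ‖volume.real (ball (0 : EuclideanSpace ℝ (Fin d)) ε) * sobFn p x
        - ∫ y in ball x ε, sobFn p y ∂(volume.restrict D)‖ₑ ≤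
      ENNReal.ofReal ε * volume (ball (0 : EuclideanSpace ℝ (Fin d)) ε) *
        (‖p‖ₑ * volume D ^ (1 / 2 : ℝ)) := by
  have : IsFiniteMeasure (volume.restrict D) := ⟨by simpa using hfin.lt_top⟩
  obtain ⟨q, hq, hqp⟩ := mem_closure_iff_seq_limit.1 p.2
  have hfst : Tendsto (fun n => (q n).fst) atTop (𝓝 (sobFn p)) :=
    ((WithLp.continuous_fst 2 _ _).tendsto _).comp hqp
  obtain ⟨ns, hns, hae⟩ := (tendstoInMeasure_of_tendsto_Lp hfst).exists_seq_tendsto_ae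
  have havg (x) : Tendsto (fun n => ∫ y in ball x ε, (q (ns n)).fst y ∂(volume.restrict D)) atTop
      (𝓝 (∫ y in ball x ε, sobFn p y ∂(volume.restrict D))) := by
    obtain ⟨l, -, hl⟩ := exists_clm_setIntegral_ball (volume.restrict D) ε x
    simp_rw [← hl]
    exact (l.continuous.tendsto _).comp (hfst.comp hns.tendsto_atTop)
  calc _ = ∫⁻ x in D, liminf (fun n => ‖volume.real (ball (0 : EuclideanSpace ℝ (Fin d)) ε)
          * (q (ns n)).fst x - ∫ y in ball x ε, (q (ns n)).fst y ∂(volume.restrict D)‖ₑ) atTop := by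
        refine lintegral_congr_ae (hae.mono fun x hx => ?_)
        exact (Tendsto.liminf_eq ((hx.const_mul _).sub (havg x)).enorm).symm
    _ ≤ liminf (fun n => ∫⁻ x in D, ‖volume.real (ball (0 : EuclideanSpace ℝ (Fin d)) ε)
          * (q (ns n)).fst x - ∫ y in ball x ε, (q (ns n)).fst y ∂(volume.restrict D)‖ₑ) atTop := by
        refine lintegral_liminf_le' fun n => ?_
        exact (((Lp.stronglyMeasurable _).const_mul _).sub
          (measurable_setIntegral_ball (Lp.stronglyMeasurable _) ε)).enorm.aemeasurable
    _ ≤ liminf (fun n => ENNReal.ofReal ε * volume (ball (0 : EuclideanSpace ℝ (Fin d)) ε) *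
        (‖q (ns n)‖ₑ * volume D ^ (1 / 2 : ℝ))) atTop := by
        refine liminf_le_liminf (Eventually.of_forall fun n => ?_)
        obtain ⟨φ, hφ, h1, h2⟩ := exists_testFunction_of_mem_span (hq (ns n))
        exact lintegral_enorm_sub_average_le_of_testFunction hφ h1 h2 ε
    _ = _ := by
        refine Tendsto.liminf_eq ?_
        have hC : volume D ^ (1 / 2 : ℝ) ≠ ⊤ := ENNReal.rpow_ne_top_of_nonneg (by norm_num) hfin
        exact ENNReal.Tendsto.const_mul (ENNReal.Tendsto.mul_const
          ((hqp.comp hns.tendsto_atTop).enorm) (Or.inr hC))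
          (Or.inr (ENNReal.mul_ne_top ENNReal.ofReal_ne_top measure_ball_lt_top.ne))

/-! ### Rellich's theorem -/

theorem lintegral_enorm_le_of_lintegral_enorm_mul_sub_le {α : Type*} [MeasurableSpace α]
    {μ : Measure α} {u g : α → ℝ} {k : ℝ} {K A : ℝ≥0∞} (hk : ‖k‖ₑ = K) (hK0 : K ≠ 0)
    (hKt : K ≠ ⊤) (hg : StronglyMeasurable g) (h : ∫⁻ x, ‖k * u x - g x‖ₑ ∂μ ≤ K * A) :
    ∫⁻ x, ‖u x‖ₑ ∂μ ≤ A + K⁻¹ * ∫⁻ x, ‖g x‖ₑ ∂μ := by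
  have key : K * ∫⁻ x, ‖u x‖ₑ ∂μ ≤ K * A + ∫⁻ x, ‖g x‖ₑ ∂μ := by
    rw [← lintegral_const_mul' _ _ hKt]
    calc _ ≤ ∫⁻ x, (‖k * u x - g x‖ₑ + ‖g x‖ₑ) ∂μ := by
          refine lintegral_mono fun x => ?_
          rw [← hk, ← enorm_mul]
          simpa using enorm_add_le (k * u x - g x) (g x)
      _ = _ := lintegral_add_right _ hg.enorm
      _ ≤ _ := by gcongr
  calc _ = K⁻¹ * (K * ∫⁻ x, ‖u x‖ₑ ∂μ) := by
        rw [← mul_assoc, ENNReal.inv_mul_cancel hK0 hKt, one_mul]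
    _ ≤ K⁻¹ * (K * A + ∫⁻ x, ‖g x‖ₑ ∂μ) := by gcongr
    _ = _ := by rw [mul_add, ← mul_assoc, ENNReal.inv_mul_cancel hK0 hKt, one_mul]

/-- **Rellich's theorem**, in the form needed here: weak convergence in `H¹₀(D)` implies strong
convergence in `L¹(D)`. -/
theorem tendsto_lintegral_enorm_of_tendsto_toWeakSpace (hfin : volume D ≠ ⊤) {v : ℕ → H10 D}
    (hv : Tendsto (fun n => toWeakSpace ℝ (H10 D) (v n)) atTop (𝓝 (toWeakSpace ℝ (H10 D) 0))) :
    Tendsto (fun n => ∫⁻ x in D, ‖sobFn (v n) x‖ₑ) atTop (𝓝 0) := by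
  have : IsFiniteMeasure (volume.restrict D) := ⟨by simpa using hfin.lt_top⟩
  obtain ⟨M, hM⟩ := exists_norm_le_of_tendsto_toWeakSpace hv
  have hfstn (n) : ‖sobFn (v n)‖ ≤ M := (WithLp.norm_fst_le _ _).trans (hM n)
  have hM0 : 0 ≤ M := (norm_nonneg _).trans (hM 0)
  set C : ℝ≥0∞ := ENNReal.ofReal M * volume D ^ (1 / 2 : ℝ)
  have hC : C ≠ ⊤ := ENNReal.mul_ne_top ENNReal.ofReal_ne_top
    (ENNReal.rpow_ne_top_of_nonneg (by norm_num) hfin)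
  -- For fixed ε the averages tend to 0 at each x by weak convergence and are bounded by a constant,
  -- which is integrable because D has finite measure.
  have havg (ε : ℝ) : Tendsto (fun n => ∫⁻ x in D,
      ‖∫ y in ball x ε, sobFn (v n) y ∂(volume.restrict D)‖ₑ) atTop (𝓝 0) := by
    have h0 : ∫⁻ _ in D, (0 : ℝ≥0∞) = 0 := by simp
    rw [← h0]
    refine tendsto_lintegral_of_dominated_convergence
      (fun _ => ENNReal.ofReal ((volume.restrict D).real univ ^ (1 / 2 : ℝ) * M)) (fun n => ?_)
      (fun n => Eventually.of_forall fun x => ?_) ?_ (Eventually.of_forall fun x => ?_)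
    · exact (measurable_setIntegral_ball (Lp.stronglyMeasurable _) ε).enorm
    · obtain ⟨l, hln, hl⟩ := exists_clm_setIntegral_ball (volume.restrict D) ε x
      simp only [← hl]
      rw [← ofReal_norm]
      refine ENNReal.ofReal_le_ofReal ((l.le_opNorm _).trans ?_)
      exact mul_le_mul hln (hfstn n) (norm_nonneg _) (by positivity)
    · simpa using ENNReal.mul_ne_top ENNReal.ofReal_ne_top hfin
    · obtain ⟨l, -, hl⟩ := exists_clm_setIntegral_ball (volume.restrict D) ε x
      simp only [← hl]
      have := (tendsto_apply_of_tendsto_toWeakSpace hv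
        (l ∘L (WithLp.fstL 2 ℝ _ _) ∘L (H10 D).subtypeL)).enorm
      simpa [sobFn] using this
  have hbound (ε : ℝ) (hε : 0 < ε) (n) : ∫⁻ x in D, ‖sobFn (v n) x‖ₑ ≤
      ENNReal.ofReal ε * C + (volume (ball (0 : EuclideanSpace ℝ (Fin d)) ε))⁻¹ *
        ∫⁻ x in D, ‖∫ y in ball x ε, sobFn (v n) y ∂(volume.restrict D)‖ₑ := by
    have h := lintegral_enorm_sub_average_le hfin (v n) ε
    -- The volume of the ball is brought to the front, to be cancelled as the factor `K`.
    rw [mul_comm (ENNReal.ofReal ε), mul_assoc] at h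
    have hM' : ‖v n‖ₑ ≤ ENNReal.ofReal M := by
      rw [← ofReal_norm]
      exact ENNReal.ofReal_le_ofReal (hM n)
    refine (lintegral_enorm_le_of_lintegral_enorm_mul_sub_le ?_ (measure_ball_pos _ _ hε).ne'
      measure_ball_lt_top.ne
      (measurable_setIntegral_ball (Lp.stronglyMeasurable _) ε) h).trans ?_
    · rw [Real.enorm_eq_ofReal measureReal_nonneg, ofReal_measureReal]
    · gcongr
      exact mul_le_mul_left hM' _
  rw [ENNReal.tendsto_nhds_zero]
  intro δ hδ
  have hlim : Tendsto (fun ε : ℝ => ENNReal.ofReal ε * C) (𝓝[>] 0) (𝓝 0) := by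
    have := ENNReal.Tendsto.mul_const (b := C)
      ((ENNReal.continuous_ofReal.tendsto 0).mono_left nhdsWithin_le_nhds :
        Tendsto ENNReal.ofReal (𝓝[>] 0) _) (Or.inr hC)
    simpa using this
  -- The radius is fixed first, making the averaging error at most δ/2 for all n; only then is n
  -- taken large.
  obtain ⟨ε, hε1, hε⟩ := ((ENNReal.tendsto_nhds_zero.1 hlim (δ / 2)
    (ENNReal.half_pos hδ.ne')).and self_mem_nhdsWithin).exists
  have hK : (volume (ball (0 : EuclideanSpace ℝ (Fin d)) ε))⁻¹ ≠ ⊤ :=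
    ENNReal.inv_ne_top.2 (measure_ball_pos _ _ hε).ne'
  have hsec := ENNReal.Tendsto.const_mul (havg ε) (Or.inr hK)
  rw [mul_zero] at hsec
  filter_upwards [ENNReal.tendsto_nhds_zero.1 hsec (δ / 2) (ENNReal.half_pos hδ.ne')] with n hn
  exact (hbound ε hε n).trans ((add_le_add hε1 hn).trans (ENNReal.add_halves δ).le)

/-! ### Lower semicontinuity -/

/-- If `vₙ → u` in measure and `f` is integrable, the `f`-mass of `{u > 0, vₙ = 0}` vanishes in
the limit. -/
theorem tendsto_setIntegral_pos_inter_eq_zero {α : Type*} [MeasurableSpace α] {μ : Measure α}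
    {f : α → ℝ} (hf : Integrable f μ) {v : ℕ → α → ℝ} {u : α → ℝ} (hv : ∀ n, Measurable (v n))
    (hu : Measurable u) (hvu : TendstoInMeasure μ v atTop u) :
    Tendsto (fun n => ∫ x in {x | 0 < u x ∧ v n x = 0}, f x ∂μ) atTop (𝓝 0) := by
  have hS (n) : MeasurableSet {x | 0 < u x ∧ v n x = 0} :=
    (measurableSet_lt measurable_const hu).inter (measurableSet_eq_fun (hv n) measurable_const)
  -- Convergence in measure gives a.e. convergence only along subsequences; it suffices that every
  -- subsequence has a further one with limit 0.
  refine tendsto_of_subseq_tendsto fun ns hns => ?_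
  obtain ⟨ms, -, hms⟩ := (hvu.comp hns).exists_seq_tendsto_ae
  refine ⟨ms, ?_⟩
  simp_rw [← integral_indicator (hS _)]
  rw [show 𝓝 (0 : ℝ) = 𝓝 (∫ _, (0 : ℝ) ∂μ) by rw [integral_zero]]
  refine tendsto_integral_of_dominated_convergence (fun x => ‖f x‖)
    (fun n => (hf.indicator (hS _)).aestronglyMeasurable) hf.norm
    (fun n => Eventually.of_forall fun x => norm_indicator_le_norm_self _ _) ?_
  filter_upwards [hms] with x hx
  refine tendsto_const_nhds.congr' ?_
  by_cases hpos : 0 < u x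
  · filter_upwards [hx.eventually (lt_mem_nhds hpos)] with n hn
    exact (indicator_of_notMem (fun h => hn.ne' h.2) _).symm
  · exact Eventually.of_forall fun n => (indicator_of_notMem (fun h => hpos h.1) _).symm

/-- The exceptional set has zero capacity, hence zero volume. -/
theorem ae_mem_of_memH10 (hD : MeasurableSet D) {Ω : Set (EuclideanSpace ℝ (Fin d))}
    {u : H10 D} (hu : MemH10 Ω u) : ∀ᵐ x ∂volume.restrict D, sobFn u x ≠ 0 → x ∈ Ω := by
  obtain ⟨r, ⟨-, hr⟩, hcap⟩ := hu
  have hnull : volume {x | x ∈ D \ Ω ∧ r x ≠ 0} = 0 :=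
    le_antisymm ((volume_le_capacity _).trans hcap.le) zero_le
  filter_upwards [hr, ae_restrict_of_ae (measure_eq_zero_iff_ae_notMem.1 hnull),
    ae_restrict_mem hD] with x hx hx' hxD hne
  by_contra hxΩ
  exact hx' ⟨⟨hxD, hxΩ⟩, hx ▸ hne⟩

theorem tendstoInMeasure_sobFn (hfin : volume D ≠ ⊤) {ws : ℕ → H10 D}
    {w : H10 D} (h : Tendsto (fun n => toWeakSpace ℝ (H10 D) (ws n)) atTop
      (𝓝 (toWeakSpace ℝ (H10 D) w))) :
    TendstoInMeasure (volume.restrict D) (fun n => sobFn (ws n)) atTop (sobFn w) := by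
  have h0 : Tendsto (fun n => toWeakSpace ℝ (H10 D) (ws n - w)) atTop
      (𝓝 (toWeakSpace ℝ (H10 D) 0)) := by
    simpa using h.sub_const (toWeakSpace ℝ (H10 D) w)
  refine tendstoInMeasure_of_tendsto_eLpNorm one_ne_zero
    (fun n => Lp.aestronglyMeasurable _) (Lp.aestronglyMeasurable _) ?_
  refine (tendsto_lintegral_enorm_of_tendsto_toWeakSpace hfin h0).congr fun n => ?_
  rw [eLpNorm_one_eq_lintegral_enorm]
  refine lintegral_congr_ae ?_
  filter_upwards [Lp.coeFn_sub (sobFn (ws n)) (sobFn w)] with x hx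
  exact congrArg _ hx

theorem weakGammaLSC_setIntegral (hD : IsOpen D) (hDb : Bornology.IsBounded D)
    {f : EuclideanSpace ℝ (Fin d) → ℝ} (hf : IntegrableOn f D volume)
    (hf0 : ∀ᵐ x ∂(volume.restrict D), 0 ≤ f x) :
    WeakGammaLSC D (fun Ω => ((∫ x in Ω, f x : ℝ) : EReal)) := by
  rintro Ωs Ω hΩs - ⟨ws, w, r, hws, hw, ⟨-, hr⟩, rfl⟩
  have hDm := hD.measurableSet
  have hm (u : H10 D) : Measurable (sobFn u) := (Lp.stronglyMeasurable _).measurable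
  have hpos : MeasurableSet {x | 0 < sobFn w x} := measurableSet_lt measurable_const (hm w)
  have hlim := tendsto_setIntegral_pos_inter_eq_zero hf (fun n => hm (ws n)) (hm w)
    (tendstoInMeasure_sobFn hDb.measure_lt_top.ne hw)
  have hΩ : ∫ x in {x | x ∈ D ∧ 0 < r x}, f x
      = ∫ x in {x | 0 < sobFn w x}, f x ∂(volume.restrict D) := by
    rw [Measure.restrict_restrict hpos]
    refine setIntegral_congr_set ?_
    filter_upwards [(ae_restrict_iff' hDm).1 hr] with x hx
    refine propext ⟨fun h => ⟨?_, h.1⟩, fun h => ⟨h.2, ?_⟩⟩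
    · exact h.2.trans_eq (hx h.1).symm
    · exact h.1.trans_eq (hx h.2)
  -- Split {w > 0} by whether wₙ vanishes: the part with wₙ = 0 is subtracted, the other lies a.e.
  -- in Ωₙ.
  have hle (n) : (∫ x in {x | x ∈ D ∧ 0 < r x}, f x)
      - ∫ x in {x | 0 < sobFn w x ∧ sobFn (ws n) x = 0}, f x ∂(volume.restrict D)
      ≤ ∫ x in Ωs n, f x := by
    have hzero : MeasurableSet {x | sobFn (ws n) x = 0} :=
      measurableSet_eq_fun (hm _) measurable_const
    have hsplit := integral_inter_add_sdiff (μ := volume.restrict D) (f := f)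
      (s := {x | 0 < sobFn w x}) hzero hf.integrableOn
    -- Comparing restricted measures avoids having to know that Ωₙ is measurable.
    have hsub : volume.restrict (D ∩ {x | sobFn (ws n) x ≠ 0}) ≤ volume.restrict (Ωs n) := by
      refine Measure.restrict_mono_ae ?_
      filter_upwards [(ae_restrict_iff' hDm).1 (ae_mem_of_memH10 hDm (hws n).1)] with x hx h
      exact hx h.1 h.2
    rw [hΩ, ← hsplit, sub_le_iff_le_add']
    refine add_le_add_right ?_ _
    have hΩD : volume.restrict (Ωs n) ≤ volume.restrict D :=
      Measure.restrict_mono (hΩs n).2 le_rfl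
    rw [Measure.restrict_restrict (hpos.diff hzero)]
    refine integral_mono_measure ((Measure.restrict_mono ?_ le_rfl).trans hsub)
      (ae_mono hΩD hf0) (Integrable.mono_measure hf hΩD)
    exact fun x hx => ⟨hx.2, hx.1.2⟩
  have hconv := hlim.const_sub (∫ x in {x | x ∈ D ∧ 0 < r x}, f x)
  rw [sub_zero] at hconv
  change ((∫ x in {x | x ∈ D ∧ 0 < r x}, f x : ℝ) : EReal) ≤ _
  rw [← ((continuous_coe_real_ereal.tendsto _).comp hconv).liminf_eq]
  exact liminf_le_liminf (Eventually.of_forall fun n => EReal.coe_le_coe_iff.2 (hle n))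

end ShapeOpt

theorem proposition4p7 {d : ℕ} (D : Set (EuclideanSpace ℝ (Fin d))) (hD : IsOpen D)
    (hDb : Bornology.IsBounded D) (f : EuclideanSpace ℝ (Fin d) → ℝ)
    (hf : IntegrableOn f D volume) (hf0 : ∀ᵐ x ∂(volume.restrict D), 0 ≤ f x) :
    ShapeOpt.WeakGammaLSC D (fun Ω => ((∫ x in Ω, f x : ℝ) : EReal)) :=
  ShapeOpt.weakGammaLSC_setIntegral hD hDb hf hf0
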